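/- There is a universal constant $c>0$ such that for all integers $d,n\ge 1$ there is a set $U\subseteq\mathbb{R}^d$ of exactly $n$ points for which the following holds. Call a set $S\subseteq U\times\{\pm1\}$ a sample. In the problem of learning halfspaces over $U$, Alice and Bob receive samples $S_a$ and $S_b$ such that some halfspace contains every $u$ with $(u,+1)\in S_a\cup S_b$ and no $u$ with $(u,-1)\in S_a\cup S_b$ (legal inputs), and they must output a function $f:U\to\{\pm1\}$ with $f(u)=y$ for every $(u,y)\in S_a\cup S_b$; the function $f$ need not be the indicator of a halfspace (improper learning). A randomized protocol is a random choice, by shared coins, of a deterministic two-party protocol tree: at each internal node the party owning it sends one bit depending on its own input, and each leaf is labelled with an output. It learns halfspaces over $U$ if on every legal input its output is correct with probability at least $2/3$. Then for every such protocol there is a legal input on which, with positive probability, it transmits at least $$c\,d\,\log_2(n/d)$$ bits. In particular, every (possibly improper and randomized) protocol that learns halfspaces over $U$ has worst-case communication complexity $\Omega(d\log(n/d))$. -/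

import Mathlib

open MeasureTheory

/-- A deterministic two-party protocol tree (Yao's model) with Alice's inputs in `X`, Bob's inputs
in `Y` and outputs in `Z`. At an internal node the owner of the node sends one bit, computed from
their own input, and the protocol continues in the corresponding child; a leaf carries the output,
on which both parties therefore agree. -/
inductive CommProtocol (X Y Z : Type*)
  | output (z : Z) : CommProtocol X Y Z
  | alice (bit : X → Bool) (next : Bool → CommProtocol X Y Z) : CommProtocol X Y Z
  | bob (bit : Y → Bool) (next : Bool → CommProtocol X Y Z) : CommProtocol X Y Z

namespace CommProtocol

variable {X Y Z : Type*}

/-- The output of the protocol on the input pair `(x, y)`. -/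
def run : CommProtocol X Y Z → X → Y → Z
  | output z, _, _ => z
  | alice bit next, x, y => (next (bit x)).run x y
  | bob bit next, x, y => (next (bit y)).run x y

/-- The number of bits transmitted by the protocol on the input pair `(x, y)`. -/
def bits : CommProtocol X Y Z → X → Y → ℕ
  | output _, _, _ => 0
  | alice bit next, x, y => (next (bit x)).bits x y + 1
  | bob bit next, x, y => (next (bit y)).bits x y + 1

end CommProtocol

/-- A randomized (public-coin) protocol: a random choice, made according to a probability measure
on a space `Ω` of coin outcomes, of a deterministic protocol tree. Private coins are the special
case in which `Ω` is a product and the bits of each party use only that party's coordinate;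
deterministic protocols are the case of a one-point `Ω`. -/
structure RandomizedProtocol (Ω : Type*) [MeasurableSpace Ω] (X Y Z : Type*) where
  /-- the distribution of the coins -/
  coins : Measure Ω
  isProbabilityMeasure_coins : IsProbabilityMeasure coins
  /-- the deterministic protocol that is executed for a given outcome of the coins -/
  tree : Ω → CommProtocol X Y Z
  measurableSet_run : ∀ x y z, MeasurableSet {ω | (tree ω).run x y = z}

/-- A (closed) halfspace of `ℝ^d`. -/
def IsHalfspace {d : ℕ} (H : Set (EuclideanSpace ℝ (Fin d))) : Prop :=
  ∃ (a : EuclideanSpace ℝ (Fin d)) (b : ℝ), a ≠ 0 ∧ H = {x | inner ℝ a x ≤ b}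

/-- A sample over `U`: a set of examples `(u, y)` with `u ∈ U` and label `y ∈ {1, -1} = ℤˣ`. -/
abbrev LabeledSample {d : ℕ} (U : Finset (EuclideanSpace ℝ (Fin d))) : Type :=
  Set (U × ℤˣ)

/-- The legal inputs of the learning problem: some halfspace contains all the positive examples of
`Sa ∪ Sb` and none of the negative ones. -/
def HalfspaceSeparable {d : ℕ} {U : Finset (EuclideanSpace ℝ (Fin d))}
    (Sa Sb : LabeledSample U) : Prop :=
  ∃ H : Set (EuclideanSpace ℝ (Fin d)), IsHalfspace H ∧
    ∀ e ∈ Sa ∪ Sb, (e.2 = 1 → (e.1 : EuclideanSpace ℝ (Fin d)) ∈ H) ∧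
      (e.2 = -1 → (e.1 : EuclideanSpace ℝ (Fin d)) ∉ H)

/-- The classifier `f` is correct on all the examples of both samples. It may be any function
`U → {1, -1}`, not only the indicator of a halfspace. -/
def ClassifiesCorrectly {d : ℕ} {U : Finset (EuclideanSpace ℝ (Fin d))}
    (f : U → ℤˣ) (Sa Sb : LabeledSample U) : Prop :=
  ∀ e ∈ Sa ∪ Sb, f e.1 = e.2

/-- The (possibly improper and randomized) protocol `P` learns halfspaces over `U`: on every legal
input pair it outputs a correct classifier with probability at least `2/3`. -/
def LearnsHalfspaces {Ω : Type*} [MeasurableSpace Ω] {d : ℕ}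
    (U : Finset (EuclideanSpace ℝ (Fin d)))
    (P : RandomizedProtocol Ω (LabeledSample U) (LabeledSample U) (U → ℤˣ)) : Prop :=
  ∀ Sa Sb : LabeledSample U, HalfspaceSeparable Sa Sb →
    2 / 3 ≤ P.coins.real {ω | ClassifiesCorrectly ((P.tree ω).run Sa Sb) Sa Sb}

/-! Fix a labeling of `U` cut out by a halfspace and give Alice all its positive examples and Bob
all its negative ones. The only correct answer is then the labeling itself, so improper learning
gains nothing. For fixed coins, `k` bits allow at most `2 ^ k` answers (`card_image_run_le`);
averaging over the coins, two thirds of the number of labelings is at most `2 ^ k`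
(`card_labelings_le`). For many labelings, place `U` on the moment curve: halfspaces there become
sign conditions on degree `d` polynomials, and the choice of `d` roots among `n` gaps yields
`n.choose d ≥ (n / d) ^ d` labelings (`exists_halfspace_labelings`). -/

namespace CommProtocol

/-- On inputs where it transmits at most `k` bits, a protocol has at most `2 ^ k` outputs. -/
theorem card_image_run_le {X Y Z : Type*} [DecidableEq Z] (p : CommProtocol X Y Z) :
    ∀ (k : ℕ) (s : Finset (X × Y)), (∀ x ∈ s, p.bits x.1 x.2 ≤ k) →
      (s.image fun x => p.run x.1 x.2).card ≤ 2 ^ k := by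
  have split : ∀ (s : Finset (X × Y)) (β : X × Y → Bool) (F : Bool → X × Y → Z),
      s.image (fun x => F (β x) x) ⊆ (s.filter (β · = true)).image (F true) ∪
        (s.filter (β · = false)).image (F false) := by
    intro s β F z hz
    obtain ⟨x, hx, rfl⟩ := Finset.mem_image.1 hz
    rcases h : β x
    · exact Finset.mem_union_right _
        (Finset.mem_image_of_mem (F false) (Finset.mem_filter.2 ⟨hx, h⟩))
    · exact Finset.mem_union_left _
        (Finset.mem_image_of_mem (F true) (Finset.mem_filter.2 ⟨hx, h⟩))
  -- Which party owns the node is irrelevant to the count, so the bit may depend on the whole pair.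
  have step : ∀ (β : X × Y → Bool) (next : Bool → CommProtocol X Y Z),
      (∀ b k, ∀ s : Finset (X × Y), (∀ x ∈ s, (next b).bits x.1 x.2 ≤ k) →
        (s.image fun x => (next b).run x.1 x.2).card ≤ 2 ^ k) →
      ∀ k, ∀ s : Finset (X × Y), (∀ x ∈ s, (next (β x)).bits x.1 x.2 + 1 ≤ k) →
        (s.image fun x => (next (β x)).run x.1 x.2).card ≤ 2 ^ k := by
    intro β next ih k s hs
    rcases k with _ | k
    · have : s = ∅ := Finset.eq_empty_of_forall_notMem fun x hx => by simpa using hs x hx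
      simp [this]
    · have key : ∀ b, ((s.filter (β · = b)).image fun x => (next b).run x.1 x.2).card ≤ 2 ^ k := by
        refine fun b => ih b k _ fun x hx => ?_
        obtain ⟨hxs, rfl⟩ := Finset.mem_filter.1 hx
        exact Nat.le_of_succ_le_succ (hs x hxs)
      calc _ ≤ _ := Finset.card_le_card (split s β fun b x => (next b).run x.1 x.2)
        _ ≤ _ := Finset.card_union_le _ _
        _ ≤ 2 ^ k + 2 ^ k := add_le_add (key true) (key false)
        _ = 2 ^ (k + 1) := by ring
  induction p with
  | output z =>
    intro k s _
    refine le_trans (Finset.card_le_card (t := {z}) ?_) (by simpa using Nat.one_le_two_pow)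
    intro w hw
    obtain ⟨x, -, rfl⟩ := Finset.mem_image.1 hw
    exact Finset.mem_singleton_self _
  | alice bit next ih => exact step (fun x => bit x.1) next ih
  | bob bit next ih => exact step (fun x => bit x.2) next ih

end CommProtocol

/-- Peel off the factor `n / k` from the binomial; the ratio `(n - 1) / (k - 1)` left over is no
smaller. -/
theorem div_pow_le_choose {n k : ℕ} (hk : 0 < k) (hkn : k ≤ n) :
    ((n : ℝ) / k) ^ k ≤ n.choose k := by
  induction k, hk using Nat.le_induction generalizing n with
  | base => simp
  | succ k hk ih =>
    obtain ⟨m, rfl⟩ : ∃ m, n = m + 1 := ⟨n - 1, by omega⟩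
    have hkm : k ≤ m := by omega
    have hk0 : (0 : ℝ) < k := by exact_mod_cast hk
    have hle : ((m + 1 : ℕ) : ℝ) / (k + 1 : ℕ) ≤ (m : ℝ) / k := by
      have : (k : ℝ) ≤ m := by exact_mod_cast hkm
      rw [div_le_div_iff₀ (by positivity) hk0]
      push_cast
      nlinarith
    have hrec : ((m + 1).choose (k + 1) : ℝ) = ((m + 1 : ℕ) : ℝ) / (k + 1 : ℕ) * m.choose k := by
      rw [div_mul_eq_mul_div, eq_div_iff (by positivity)]
      exact_mod_cast (Nat.add_one_mul_choose_eq m k).symm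
    rw [hrec, pow_succ']
    gcongr
    exact (pow_le_pow_left₀ (by positivity) hle k).trans (ih hkm)

/-! ### Halfspace labelings of the moment curve -/

/-- The point of the moment curve in `ℝ^d` with parameter `t`. -/
noncomputable def momentCurve (d : ℕ) (t : ℝ) : EuclideanSpace ℝ (Fin d) :=
  WithLp.toLp 2 fun i => t ^ ((i : ℕ) + 1)

theorem momentCurve_injective {d : ℕ} (hd : 0 < d) : Function.Injective (momentCurve d) := by
  intro s t h
  simpa [momentCurve] using congrArg (fun x => x ⟨0, hd⟩) h

/-- A halfspace cuts the moment curve along the nonpositive set of any given monic polynomial of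
degree `d`. -/
theorem exists_isHalfspace_momentCurve_mem_iff {d : ℕ} (hd : 0 < d) {p : Polynomial ℝ}
    (hp : p.Monic) (hdeg : p.natDegree = d) :
    ∃ H : Set (EuclideanSpace ℝ (Fin d)), IsHalfspace H ∧
      ∀ t, momentCurve d t ∈ H ↔ p.eval t ≤ 0 := by
  set a : EuclideanSpace ℝ (Fin d) := WithLp.toLp 2 fun i => p.coeff (i + 1) with ha
  refine ⟨{x | inner ℝ a x ≤ -p.coeff 0}, ⟨a, _, fun h => ?_, rfl⟩, fun t => ?_⟩
  · have h1 : p.coeff (d - 1 + 1) = 0 := congrArg (fun x => x ⟨d - 1, by omega⟩) h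
    rw [Nat.sub_add_cancel hd, ← hdeg, hp.coeff_natDegree] at h1
    exact one_ne_zero h1
  · have : p.eval t = inner ℝ a (momentCurve d t) + p.coeff 0 := by
      rw [Polynomial.eval_eq_sum_range, hdeg, Finset.sum_range_succ', Finset.sum_range]
      simp [ha, momentCurve, PiLp.inner_apply, mul_comm]
    rw [Set.mem_ofPred_eq, this]
    constructor <;> intro h <;> linarith

/-- The monic polynomial with simple roots at `r + 1 / 2` for `r ∈ R`. -/
noncomputable def halfIntegerPoly (R : Finset ℕ) : Polynomial ℝ :=
  ∏ r ∈ R, (Polynomial.X - Polynomial.C ((r : ℝ) + 1 / 2))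

theorem halfIntegerPoly_monic (R : Finset ℕ) : (halfIntegerPoly R).Monic :=
  Polynomial.monic_prod_of_monic _ _ fun _ _ => Polynomial.monic_X_sub_C _

theorem natDegree_halfIntegerPoly (R : Finset ℕ) : (halfIntegerPoly R).natDegree = R.card := by
  rw [halfIntegerPoly, Polynomial.natDegree_prod_of_monic _ _
    fun _ _ => Polynomial.monic_X_sub_C _]
  simp only [Polynomial.natDegree_X_sub_C, Finset.sum_const, smul_eq_mul, mul_one]

/-- The sign is `-1` to the number of roots above `t`; half-integer roots never vanish at an
integer. -/
theorem eval_halfIntegerPoly_nonpos_iff (R : Finset ℕ) (t : ℕ) :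
    (halfIntegerPoly R).eval (t : ℝ) ≤ 0 ↔ Odd (R.filter (t ≤ ·)).card := by
  have h : 0 < (-1 : ℝ) ^ (R.filter (t ≤ ·)).card * (halfIntegerPoly R).eval (t : ℝ) := by
    rw [← Finset.prod_const, Finset.prod_filter, halfIntegerPoly, Polynomial.eval_prod,
      ← Finset.prod_mul_distrib]
    refine Finset.prod_pos fun r _ => ?_
    simp only [Polynomial.eval_sub, Polynomial.eval_X, Polynomial.eval_C]
    split_ifs with htr
    · have : (t : ℝ) ≤ r := by exact_mod_cast htr
      linarith
    · have : (r : ℝ) + 1 ≤ t := by exact_mod_cast not_le.1 htr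
      linarith
  rcases Nat.even_or_odd (R.filter (t ≤ ·)).card with he | ho
  · rw [he.neg_one_pow, one_mul] at h
    exact iff_of_false h.not_ge (Nat.not_odd_iff_even.2 he)
  · rw [ho.neg_one_pow] at h
    exact iff_of_true (by linarith) ho

/-- The tail parity changes from `t` to `t + 1` exactly when `t ∈ R`, so the parities recover `R`;
from `n` on the tails are empty. -/
theorem eq_of_odd_card_filter_iff {n : ℕ} {R R' : Finset ℕ} (hR : R ⊆ Finset.range n)
    (hR' : R' ⊆ Finset.range n)
    (h : ∀ t < n, Odd (R.filter (t ≤ ·)).card ↔ Odd (R'.filter (t ≤ ·)).card) : R = R' := by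
  have hle : ∀ t, Odd (R.filter (t ≤ ·)).card ↔ Odd (R'.filter (t ≤ ·)).card := by
    intro t
    by_cases ht : t < n
    · exact h t ht
    · have : ∀ Q : Finset ℕ, Q ⊆ Finset.range n → Q.filter (t ≤ ·) = ∅ := by
        refine fun Q hQ => Finset.filter_eq_empty_iff.2 fun r hr => ?_
        have := Finset.mem_range.1 (hQ hr)
        omega
      rw [this R hR, this R' hR']
  have hmem : ∀ (Q : Finset ℕ) (t : ℕ),
      t ∈ Q ↔ ¬(Odd (Q.filter (t ≤ ·)).card ↔ Odd (Q.filter (t + 1 ≤ ·)).card) := by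
    intro Q t
    by_cases ht : t ∈ Q
    · have : Q.filter (t ≤ ·) = insert t (Q.filter (t + 1 ≤ ·)) := by
        ext r
        simp only [Finset.mem_filter, Finset.mem_insert]
        grind
      rw [this, Finset.card_insert_of_notMem (by simp), Nat.odd_add_one]
      tauto
    · have : Q.filter (t ≤ ·) = Q.filter (t + 1 ≤ ·) :=
        Finset.filter_congr fun r hr => by grind
      simp [this, ht]
  ext t
  rw [hmem R, hmem R', hle t, hle (t + 1)]

/-- The first `n` natural parameters on the moment curve. -/
noncomputable def momentPoints (d n : ℕ) : Finset (EuclideanSpace ℝ (Fin d)) := by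
  classical exact (Finset.range n).image fun t : ℕ => momentCurve d t

theorem mem_momentPoints {d n t : ℕ} (ht : t < n) : momentCurve d t ∈ momentPoints d n := by
  classical exact Finset.mem_image_of_mem (fun t : ℕ => momentCurve d t) (Finset.mem_range.2 ht)

theorem card_momentPoints {d : ℕ} (hd : 0 < d) (n : ℕ) : (momentPoints d n).card = n := by
  classical
  exact (Finset.card_image_of_injective _
    ((momentCurve_injective hd).comp Nat.cast_injective)).trans (Finset.card_range n)

/-- The halfspaces of `ℝ^d` induce at least `n.choose d` labelings of `n` points of the moment
curve. -/
theorem exists_halfspace_labelings {d : ℕ} (hd : 0 < d) (n : ℕ) :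
    ∃ L : Finset (momentPoints d n → ℤˣ), L.card = n.choose d ∧
      ∀ h ∈ L, ∃ H : Set (EuclideanSpace ℝ (Fin d)), IsHalfspace H ∧
        ∀ u, h u = 1 ↔ (u : EuclideanSpace ℝ (Fin d)) ∈ H := by
  classical
  have hex : ∀ R : Finset ℕ, ∃ H : Set (EuclideanSpace ℝ (Fin d)), R.card = d →
      IsHalfspace H ∧ ∀ t : ℕ, momentCurve d t ∈ H ↔ Odd (R.filter (t ≤ ·)).card := by
    intro R
    by_cases hR : R.card = d
    · obtain ⟨H, hH, hmem⟩ := exists_isHalfspace_momentCurve_mem_iff hd (halfIntegerPoly_monic R)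
        ((natDegree_halfIntegerPoly R).trans hR)
      exact ⟨H, fun _ => ⟨hH, fun t => (hmem t).trans (eval_halfIntegerPoly_nonpos_iff R t)⟩⟩
    -- A junk value that makes `H` a total function of `R`.
    · exact ⟨∅, fun h => absurd h hR⟩
  choose H hH using hex
  let label : Finset ℕ → momentPoints d n → ℤˣ := fun R u => 
    if (u : EuclideanSpace ℝ (Fin d)) ∈ H R then 1 else -1
  have hlabel : ∀ R u, label R u = 1 ↔ (u : EuclideanSpace ℝ (Fin d)) ∈ H R := by
    intro R u
    by_cases h : (u : EuclideanSpace ℝ (Fin d)) ∈ H R <;> simp [label, h]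
  refine ⟨((Finset.range n).powersetCard d).image label, ?_, fun h hh => ?_⟩
  · rw [Finset.card_image_of_injOn, Finset.card_powersetCard, Finset.card_range]
    intro R hR R' hR' heq
    obtain ⟨hR, hRd⟩ := Finset.mem_powersetCard.1 hR
    obtain ⟨hR', hRd'⟩ := Finset.mem_powersetCard.1 hR'
    refine eq_of_odd_card_filter_iff hR hR' fun t ht => ?_
    rw [← (hH R hRd).2 t, ← (hH R' hRd').2 t, ← hlabel R ⟨_, mem_momentPoints ht⟩,
      ← hlabel R' ⟨_, mem_momentPoints ht⟩, heq]
  · obtain ⟨R, hR, rfl⟩ := Finset.mem_image.1 hh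
    exact ⟨H R, (hH R (Finset.mem_powersetCard.1 hR).2).1, hlabel R⟩

/-! ### From protocols to counting labelings -/

section Learning

variable {d : ℕ} {U : Finset (EuclideanSpace ℝ (Fin d))}

/-- The examples of the labeling `h` that carry the label `y`. -/
def labeledPart (h : U → ℤˣ) (y : ℤˣ) : LabeledSample U := {e | e.2 = y ∧ h e.1 = y}

theorem mem_labeledPart_union (h : U → ℤˣ) (e : U × ℤˣ) :
    e ∈ labeledPart h 1 ∪ labeledPart h (-1) ↔ h e.1 = e.2 := by
  rcases Int.units_eq_one_or e.2 with he | he <;> simp [labeledPart, he]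

theorem classifiesCorrectly_labeledPart_iff {f h : U → ℤˣ} :
    ClassifiesCorrectly f (labeledPart h 1) (labeledPart h (-1)) ↔ f = h := by
  constructor
  · exact fun hf => funext fun u => hf (u, h u) ((mem_labeledPart_union h _).2 rfl)
  · rintro rfl e he
    exact (mem_labeledPart_union f e).1 he

theorem halfspaceSeparable_labeledPart {h : U → ℤˣ} {H : Set (EuclideanSpace ℝ (Fin d))}
    (hH : IsHalfspace H) (hmem : ∀ u, h u = 1 ↔ (u : EuclideanSpace ℝ (Fin d)) ∈ H) :
    HalfspaceSeparable (labeledPart h 1) (labeledPart h (-1)) := by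
  refine ⟨H, hH, fun e he => ?_⟩
  rw [mem_labeledPart_union] at he
  rw [← hmem, he]
  refine ⟨id, fun h1 => ?_⟩
  rw [h1]
  decide

/-- If the output is right with probability `2 / 3` on each of a set of labelings and at most `k`
bits are transmitted almost surely, then there are at most `(3 / 2) * 2 ^ k` labelings. -/
theorem card_labelings_le {Ω : Type*} [MeasurableSpace Ω]
    (P : RandomizedProtocol Ω (LabeledSample U) (LabeledSample U) (U → ℤˣ))
    (L : Finset (U → ℤˣ)) (k : ℕ)
    (hcorrect : ∀ h ∈ L, 2 / 3 ≤ P.coins.real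
      {ω | (P.tree ω).run (labeledPart h 1) (labeledPart h (-1)) = h})
    (hbits : ∀ h ∈ L, ∀ᵐ ω ∂P.coins,
      (P.tree ω).bits (labeledPart h 1) (labeledPart h (-1)) ≤ k) :
    2 / 3 * (L.card : ℝ) ≤ 2 ^ k := by
  classical
  have := P.isProbabilityMeasure_coins
  set E : (U → ℤˣ) → Set Ω := fun h =>
    {ω | (P.tree ω).run (labeledPart h 1) (labeledPart h (-1)) = h} with hE
  have hmeas : ∀ h, MeasurableSet (E h) := fun h => P.measurableSet_run _ _ h
  have hint : ∀ h ∈ L, Integrable ((E h).indicator (1 : Ω → ℝ)) P.coins := fun h _ =>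
    (integrable_const (1 : ℝ)).indicator (hmeas h)
  -- For fixed coins, labelings answered correctly are distinct outputs of one short protocol.
  have hcount : ∀ᵐ ω ∂P.coins, ∑ h ∈ L, (E h).indicator (1 : Ω → ℝ) ω ≤ 2 ^ k := by
    filter_upwards [(Finset.eventually_all L).2 hbits] with ω hω
    have hcard := (P.tree ω).card_image_run_le k
      (L.image fun h => (labeledPart h 1, labeledPart h (-1))) (by simpa using hω)
    have hsub : L.filter (ω ∈ E ·) ⊆ (L.image fun h => (labeledPart h 1, labeledPart h (-1))).image
        fun x => (P.tree ω).run x.1 x.2 := by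
      intro h hh
      obtain ⟨hL, hrun⟩ := Finset.mem_filter.1 hh
      exact Finset.mem_image.2 ⟨_, Finset.mem_image_of_mem _ hL, hrun⟩
    have hsum : ∑ h ∈ L, (E h).indicator (1 : Ω → ℝ) ω = (L.filter (ω ∈ E ·)).card := by
      rw [Finset.card_filter, Nat.cast_sum]
      refine Finset.sum_congr rfl fun h _ => ?_
      by_cases hω : ω ∈ E h <;> simp [hω]
    rw [hsum]
    exact_mod_cast (Finset.card_le_card hsub).trans hcard
  calc 2 / 3 * (L.card : ℝ) = ∑ h ∈ L, (2 / 3 : ℝ) := by simp [mul_comm]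
    _ ≤ ∑ h ∈ L, P.coins.real (E h) := Finset.sum_le_sum hcorrect
    _ = ∫ ω, ∑ h ∈ L, (E h).indicator (1 : Ω → ℝ) ω ∂P.coins := by
      rw [integral_finsetSum L hint]
      exact Finset.sum_congr rfl fun h _ => (integral_indicator_one (hmeas h)).symm
    _ ≤ ∫ _, (2 : ℝ) ^ k ∂P.coins :=
      integral_mono_ae (integrable_finsetSum L hint) (integrable_const _) hcount
    _ = 2 ^ k := by simp

end Learning

/-! ### Numerical estimate and conclusion -/

theorem two_pow_lt_choose {d n k : ℕ} (hd : 0 < d) (hdn : d < n)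
    (hk : (k : ℝ) < 1 / 4 * (d * Real.logb 2 ((n : ℝ) / d))) :
    (2 : ℝ) ^ k < 2 / 3 * n.choose d := by
  have hd0 : (0 : ℝ) < d := by exact_mod_cast hd
  have hn0 : (0 : ℝ) < n := by exact_mod_cast hd.trans hdn
  -- Bernoulli, using `n / d ≥ 1 + 1 / d`.
  have hx : (2 : ℝ) ≤ ((n : ℝ) / d) ^ d := by
    have h1 : 1 + 1 / (d : ℝ) ≤ (n : ℝ) / d := by
      have : (d : ℝ) + 1 ≤ n := by exact_mod_cast hdn
      rw [le_div_iff₀ hd0, add_mul, one_div_mul_cancel hd0.ne']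
      linarith
    have h0 : 0 < 1 / (d : ℝ) := by positivity
    have h2 := one_add_mul_le_pow (a := 1 / (d : ℝ)) (by linarith) d
    rw [mul_one_div_cancel hd0.ne'] at h2
    exact le_trans (by linarith) (h2.trans (pow_le_pow_left₀ (by positivity) h1 d))
  have hpow : ((2 : ℝ) ^ k) ^ 4 < ((n : ℝ) / d) ^ d := by
    rw [← pow_mul, ← Real.logb_lt_logb_iff one_lt_two (by positivity) (by positivity),
      Real.logb_pow, Real.logb_pow, Real.logb_self_eq_one one_lt_two]
    push_cast
    linarith
  have hchoose := div_pow_le_choose hd hdn.le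
  have hy : (1 : ℝ) ≤ 2 ^ k := one_le_pow₀ one_le_two
  set y : ℝ := 2 ^ k
  -- The constant `1 / 4` absorbs the factor `2 / 3`: otherwise `2 ≤ (n / d) ^ d ≤ 3 / 2 * y`, so `y
  -- ≥ 4 / 3`, while `y ^ 4 < 3 / 2 * y` forces `y ^ 3 < 3 / 2`.
  by_contra! hcon
  nlinarith [mul_nonneg (sub_nonneg.2 hy) (sq_nonneg y), sq_nonneg (y ^ 2 - 1), sq_nonneg (y - 1)]

theorem theorem2 :
    ∃ c : ℝ, 0 < c ∧ ∀ d n : ℕ, 0 < d → 0 < n →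
      ∃ U : Finset (EuclideanSpace ℝ (Fin d)), U.card = n ∧
        ∀ (Ω : Type*) [MeasurableSpace Ω]
          (P : RandomizedProtocol Ω (LabeledSample U) (LabeledSample U) (U → ℤˣ)),
          LearnsHalfspaces U P →
            ∃ Sa Sb : LabeledSample U, HalfspaceSeparable Sa Sb ∧
              ∃ᵐ ω ∂P.coins,
                c * (d * Real.logb 2 ((n : ℝ) / d)) ≤ ((P.tree ω).bits Sa Sb : ℝ) := by
  refine ⟨1 / 4, by norm_num, fun d n hd hn => ⟨momentPoints d n, card_momentPoints hd n, ?_⟩⟩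
  intro Ω _ P hP
  have := P.isProbabilityMeasure_coins
  obtain ⟨L, hcard, hL⟩ := exists_halfspace_labelings hd n
  by_contra! hcon
  have hd0 : (0 : ℝ) < d := by exact_mod_cast hd
  set B : ℝ := 1 / 4 * (d * Real.logb 2 ((n : ℝ) / d)) with hB
  have hlt : ∀ Sa Sb : LabeledSample (momentPoints d n), HalfspaceSeparable Sa Sb →
      ∀ᵐ ω ∂P.coins, ((P.tree ω).bits Sa Sb : ℝ) < B := by
    intro Sa Sb h
    simpa [Filter.not_frequently] using hcon Sa Sb h
  -- The empty samples are legal and cost at least `0` bits, so the bound being refuted is positive;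
  -- this excludes `n ≤ d`.
  have hBpos : 0 < B := by
    obtain ⟨H, hH, -⟩ := exists_isHalfspace_momentCurve_mem_iff hd
      (halfIntegerPoly_monic (Finset.range d))
      ((natDegree_halfIntegerPoly _).trans (Finset.card_range d))
    obtain ⟨ω, hω⟩ := (hlt ∅ ∅ ⟨H, hH, by simp⟩).exists
    exact (Nat.cast_nonneg _).trans_lt hω
  have hdn : d < n := by
    by_contra! hnd
    have : Real.logb 2 ((n : ℝ) / d) ≤ 0 :=
      Real.logb_nonpos one_lt_two (by positivity)
        ((div_le_one hd0).2 (by exact_mod_cast hnd))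
    nlinarith
  -- `k` is the largest natural number strictly below `B`, so fewer than `B` bits means at most `k`.
  obtain ⟨k, hk⟩ : ∃ k, ⌈B⌉₊ = k + 1 := Nat.exists_eq_succ_of_ne_zero (Nat.ceil_pos.2 hBpos).ne'
  have hkB : (k : ℝ) < B := Nat.lt_ceil.1 (by omega)
  have hle := card_labelings_le P L k
    (fun h hh => by
      obtain ⟨H, hH, hmem⟩ := hL h hh
      simpa only [classifiesCorrectly_labeledPart_iff] using
        hP _ _ (halfspaceSeparable_labeledPart hH hmem))
    (fun h hh => by
      obtain ⟨H, hH, hmem⟩ := hL h hh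
      filter_upwards [hlt _ _ (halfspaceSeparable_labeledPart hH hmem)] with ω hω
      have := Nat.lt_ceil.2 hω
      omega)
  rw [hcard] at hle
  exact hle.not_gt (two_pow_lt_choose hd hdn hkB)
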